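/- For a symmetric stress tensor $\sigma$ let $S=\sigma-\frac{\operatorname{tr}\sigma}{3}I$, $J_2=\frac12\operatorname{tr}S^2$, $J_3=\frac13\operatorname{tr}S^3$, $p=-\frac{\operatorname{tr}\sigma}{3}$, $q=\sqrt{3J_2}$ and $\theta=\frac13\arccos\left(\frac{3\sqrt3}{2}\frac{J_3}{J_2^{3/2}}\right)\in[0,\pi/3]$, with $q/g(\theta)=0$ where $J_2=0$. Let $S_1,S_2$ be two principal values of $S$ (the third is $S_3=-S_1-S_2$). Let $g$ be a real function, continuous and strictly positive on $[0,\pi/3]$, and twice differentiable at all but finitely many points of $(0,\pi/3)$. Call $\theta_i\in(0,\pi/3)$ a singular point of $g$ if $g$ is not differentiable at $\theta_i$. Then for every real $p_0$ and every $k>0$ the following are equivalent: (i) $q/g(\theta)$ is a convex function of $(S_1,S_2)\in\mathbb R^2$; (ii) the deviatoric section in the Haigh--Westergaard space, that is, the set of all principal stresses $(\sigma_1,\sigma_2,\sigma_3)\in\mathbb R^3$ with $p=p_0$ and $q/g(\theta)\le k$, is convex; (iii) $g^2+2(g')^2-g\,g''\ge 0$ at every $\theta\in(0,\pi/3)$ at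 which $g$ is twice differentiable; the one-sided derivatives $g'(0)$ and $g'(\pi/3)$ exist and satisfy $g'(0)\le 0$ and $g'(\pi/3)\ge 0$; and at every singular point $\theta_i$ the one-sided derivatives of $g$ exist and satisfy $g'_-(\theta_i)>g'_+(\theta_i)$. -/

import Mathlib

open Real Set

noncomputable section

namespace Yield

/-- Deviatoric part `S = σ - (tr σ / 3) I` of a stress tensor. -/
def deviator (σ : Matrix (Fin 3) (Fin 3) ℝ) : Matrix (Fin 3) (Fin 3) ℝ :=
  σ - (σ.trace / 3) • (1 : Matrix (Fin 3) (Fin 3) ℝ)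

/-- Second invariant of the deviatoric stress, `J₂ = tr S² / 2`. -/
def J2 (σ : Matrix (Fin 3) (Fin 3) ℝ) : ℝ := (deviator σ ^ 2).trace / 2

/-- Third invariant of the deviatoric stress, `J₃ = tr S³ / 3`. -/
def J3 (σ : Matrix (Fin 3) (Fin 3) ℝ) : ℝ := (deviator σ ^ 3).trace / 3

/-- Mean pressure `p = - tr σ / 3`. -/
def pressure (σ : Matrix (Fin 3) (Fin 3) ℝ) : ℝ := -σ.trace / 3

/-- The invariant `q = √(3 J₂)`. -/
def q (σ : Matrix (Fin 3) (Fin 3) ℝ) : ℝ := √(3 * J2 σ)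

/-- The Lode angle `θ = (1/3) arccos ((3√3/2) J₃ / J₂^(3/2))`, with values in `[0, π/3]`. On the
hydrostatic axis, where `J₂ = 0`, its value is irrelevant, because it occurs only together with
the factor `q = 0`. -/
def lode (σ : Matrix (Fin 3) (Fin 3) ℝ) : ℝ :=
  arccos (3 * √3 / 2 * (J3 σ / J2 σ ^ (3 / 2 : ℝ))) / 3

/-- The deviatoric part `q / g(θ)` of the yield function. -/
def devPart (g : ℝ → ℝ) (σ : Matrix (Fin 3) (Fin 3) ℝ) : ℝ := q σ / g (lode σ)

/-- The deviatoric part `q / g(θ)` as a function of two principal values `S₁, S₂` of the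
deviatoric stress, the third one being `S₃ = -S₁ - S₂`. -/
def devFun (g : ℝ → ℝ) (S : ℝ × ℝ) : ℝ :=
  devPart g (Matrix.diagonal ![S.1, S.2, -S.1 - S.2])

/-- The deviatoric section, at mean pressure `p` and level `k`, in the Haigh-Westergaard space of
principal stresses: the points of the plane of mean pressure `p` with `q / g(θ) ≤ k`. For the
yield function `f(p) + q / g(θ)` this is the section of the elastic domain with `k = -f(p)`. -/
def devSection (g : ℝ → ℝ) (p k : ℝ) : Set (Fin 3 → ℝ) :=
  {s | pressure (Matrix.diagonal s) = p ∧ devPart g (Matrix.diagonal s) ≤ k}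

/-- `g` is twice differentiable at `θ`. -/
def TwiceDiffAt (g : ℝ → ℝ) (θ : ℝ) : Prop :=
  (∀ᶠ t in nhds θ, DifferentiableAt ℝ g t) ∧ DifferentiableAt ℝ (deriv g) θ

/-- The singular points of `g` in `(0, π/3)`: those at which `g` has no derivative. -/
def singularPoints (g : ℝ → ℝ) : Set ℝ :=
  {θ | θ ∈ Ioo 0 (π / 3) ∧ ¬ DifferentiableAt ℝ g θ}

end Yield

end

/-! On the deviatoric plane `q` and `θ` are polar coordinates of a sector of opening `π/3`, and
permuting the stresses reflects that sector over the whole plane. Hence `q / g(θ)` is a nonnegative,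
positively homogeneous function, invariant under permutations and hydrostatic shifts. For such a
function convexity amounts to convexity of one sublevel set (`convex_devSection_iff`).

Inside the sector the function is the perspective of its restriction `chart g` to the line `r cos θ
= 1`, with `t = tan θ ∈ [0, √3]`. The second derivative of `chart g` is `cos³ θ (g² + 2g'² - g g'')
/ g³`, and a drop in the slope of `g` is a rise in that of `chart g`. So the interior conditions
make `chart g` convex (`convexOn_chart`).

The conditions at `0` and `π/3` govern the walls of the sector: they force the supporting
functionals at ordered stresses to have ordered coefficients (`exists_supporting_line_chart`), and
the rearrangement inequality then makes these functionals global minorants (`convexOn_devStress`).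
Conversely, a convex function has one-sided derivatives along the line, and averaging a stress with
its mirror image in a wall gives the end conditions (`conditions_of_convexOn`). -/

/-! ### Convex functions on an interval -/

/-- Two convex pieces glue to a convex function when the slope does not drop at the junction. -/
theorem ConvexOn.glue_Icc {f : ℝ → ℝ} {a b c l r : ℝ} (hac : a < c) (hcb : c < b)
    (h₁ : ConvexOn ℝ (Icc a c) f) (h₂ : ConvexOn ℝ (Icc c b) f)
    (hl : HasDerivWithinAt f l (Iic c) c) (hr : HasDerivWithinAt f r (Ici c) c) (hlr : l ≤ r) :
    ConvexOn ℝ (Icc a b) f := by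
  have hleft : ∀ x, a ≤ x → x < c → f c - f x ≤ l * (c - x) := by
    intro x hax hxc
    have h := h₁.slope_le_of_hasDerivWithinAt_Iio ⟨hax, hxc.le⟩ ⟨hac.le, le_rfl⟩ hxc
      (hl.mono Iio_subset_Iic_self)
    rwa [slope_def_field, div_le_iff₀ (by linarith)] at h
  have hright : ∀ z, c < z → z ≤ b → r * (z - c) ≤ f z - f c := by
    intro z hcz hzb
    have h := h₂.le_slope_of_hasDerivWithinAt_Ioi ⟨le_rfl, hcb.le⟩ ⟨hcz.le, hzb⟩ hcz
      (hr.mono Ioi_subset_Ici_self)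
    rwa [slope_def_field, le_div_iff₀ (by linarith)] at h
  refine convexOn_of_slope_mono_adjacent (convex_Icc a b) ?_
  intro x y z hx hz hxy hyz
  rcases le_or_gt z c with hzc | hcz
  · exact h₁.slope_mono_adjacent ⟨hx.1, by linarith⟩ ⟨by linarith [hx.1], hzc⟩ hxy hyz
  rcases le_or_gt c x with hcx | hxc
  · exact h₂.slope_mono_adjacent ⟨hcx, hx.2⟩ ⟨hcz.le, hz.2⟩ hxy hyz
  have hL := hleft x hx.1 hxc
  have hR := hright z hcz hz.2
  rcases lt_trichotomy y c with hyc | rfl | hcy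
  -- The slope over `[y, z]` is a weighted mean of those over `[y, c]` and `[c, z]`; the first is at
  -- most `r`, the second at least `r`.
  · have h := h₁.slope_mono_adjacent ⟨hx.1, hxc.le⟩ ⟨hac.le, le_rfl⟩ hxy hyc
    refine h.trans ?_
    have hL' := hleft y (by linarith [hx.1]) hyc
    have hm : (f c - f y) / (c - y) ≤ r :=
      ((div_le_iff₀ (by linarith)).2 hL').trans hlr
    rw [le_div_iff₀ (by linarith)]
    have e : (f c - f y) / (c - y) * (c - y) = f c - f y := div_mul_cancel₀ _ (by linarith)
    have := mul_le_mul_of_nonneg_right hm (show 0 ≤ z - c by linarith)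
    nlinarith
  · exact ((div_le_iff₀ (by linarith)).2 hL).trans (hlr.trans ((le_div_iff₀ (by linarith)).2 hR))
  · have h := h₂.slope_mono_adjacent ⟨le_rfl, hcb.le⟩ ⟨hcz.le, hz.2⟩ hcy hyz
    refine le_trans ?_ h
    have hR' := hright y hcy (by linarith [hz.2])
    have hm : l ≤ (f y - f c) / (y - c) :=
      hlr.trans ((le_div_iff₀ (by linarith)).2 hR')
    rw [div_le_iff₀ (by linarith)]
    have e : (f y - f c) / (y - c) * (y - c) = f y - f c := div_mul_cancel₀ _ (by linarith)
    have := mul_le_mul_of_nonneg_right hm (show 0 ≤ c - x by linarith)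
    nlinarith

/-- A continuous function on an interval is convex if, off finitely many points, its second
derivative is nonnegative, and at the exceptional points its slope does not drop. -/
theorem convexOn_Icc_of_piecewise {f f' f'' : ℝ → ℝ} (B : Finset ℝ) : ∀ {a b : ℝ}, a < b →
    ContinuousOn f (Icc a b) →
    (∀ x ∈ Ioo a b, x ∉ B → HasDerivAt f (f' x) x ∧ HasDerivAt f' (f'' x) x ∧ 0 ≤ f'' x) →
    (∀ x ∈ Ioo a b, x ∈ B → ∃ l r,
      HasDerivWithinAt f l (Iic x) x ∧ HasDerivWithinAt f r (Ici x) x ∧ l ≤ r) →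
    ConvexOn ℝ (Icc a b) f := by
  -- The endpoints stay general, since the induction cuts the interval at the inserted point.
  induction B using Finset.induction_on with
  | empty =>
    intro a b _ hc h _
    refine convexOn_of_hasDerivWithinAt2_nonneg (f' := f') (f'' := f'') (convex_Icc a b) hc ?_ ?_ ?_
      <;> rw [interior_Icc] <;> intro x hx
    · exact (h x hx (by simp)).1.hasDerivWithinAt
    · exact (h x hx (by simp)).2.1.hasDerivWithinAt
    · exact (h x hx (by simp)).2.2
  | insert c B _ ih =>
    intro a b hab hc h hB
    by_cases hcab : c ∈ Ioo a b
    · obtain ⟨l, r, hl, hr, hlr⟩ := hB c hcab (Finset.mem_insert_self c B)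
      refine ConvexOn.glue_Icc hcab.1 hcab.2 ?_ ?_ hl hr hlr
      · refine ih hcab.1 (hc.mono (Icc_subset_Icc_right hcab.2.le)) ?_ ?_ <;> intro x hx hxB
        · exact h x ⟨hx.1, hx.2.trans hcab.2⟩ (by simp [hxB, hx.2.ne])
        · exact hB x ⟨hx.1, hx.2.trans hcab.2⟩ (by simp [hxB])
      · refine ih hcab.2 (hc.mono (Icc_subset_Icc_left hcab.1.le)) ?_ ?_ <;> intro x hx hxB
        · exact h x ⟨hcab.1.trans hx.1, hx.2⟩ (by simp [hxB, hx.1.ne'])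
        · exact hB x ⟨hcab.1.trans hx.1, hx.2⟩ (by simp [hxB])
    · refine ih hab hc ?_ ?_ <;> intro x hx hxB
      · exact h x hx (by
          rw [Finset.mem_insert, not_or]
          exact ⟨fun e => hcab (e ▸ hx), hxB⟩)
      · exact hB x hx (by simp [hxB])

/-- A convex function on an interval with one-sided derivatives at the ends has a supporting line
at each point. -/
theorem ConvexOn.exists_supporting_line_Icc {f : ℝ → ℝ} {a b l r : ℝ} (hab : a < b)
    (hf : ConvexOn ℝ (Icc a b) f) (hr : HasDerivWithinAt f r (Ici a) a)
    (hl : HasDerivWithinAt f l (Iic b) b) {t : ℝ} (ht : t ∈ Icc a b) :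
    ∃ m, r ≤ m ∧ m ≤ l ∧ ∀ x ∈ Icc a b, f t + m * (x - t) ≤ f x := by
  have hA : ∀ x ∈ Icc a b, f a + r * (x - a) ≤ f x := by
    intro x hx
    rcases hx.1.eq_or_lt with rfl | h
    · simp
    have h' := hf.le_slope_of_hasDerivWithinAt_Ioi ⟨le_rfl, hab.le⟩ hx h
      (hr.mono Ioi_subset_Ici_self)
    rw [slope_def_field, le_div_iff₀ (by linarith)] at h'
    linarith
  have hB : ∀ x ∈ Icc a b, f b + l * (x - b) ≤ f x := by
    intro x hx
    rcases hx.2.eq_or_lt with rfl | h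
    · simp
    have h' := hf.slope_le_of_hasDerivWithinAt_Iio hx ⟨hab.le, le_rfl⟩ h
      (hl.mono Iio_subset_Iic_self)
    rw [slope_def_field, div_le_iff₀ (by linarith)] at h'
    linarith
  have ha : a ∈ Icc a b := ⟨le_rfl, hab.le⟩
  have hb : b ∈ Icc a b := ⟨hab.le, le_rfl⟩
  have hrl : r ≤ l := by
    have h1 := hA b hb
    have h2 := hB a ha
    nlinarith
  rcases ht.1.eq_or_lt with rfl | hat
  · exact ⟨r, le_rfl, hrl, hA⟩
  rcases ht.2.eq_or_lt with rfl | htb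
  · exact ⟨l, hrl, le_rfl, hB⟩
  have hti : t ∈ interior (Icc a b) := by rw [interior_Icc]; exact ⟨hat, htb⟩
  have hlr := hf.leftDeriv_le_rightDeriv_of_mem_interior hti
  set m := derivWithin f (Ioi t) t
  have hm : ∀ x ∈ Icc a b, f t + m * (x - t) ≤ f x := by
    intro x hx
    rcases lt_trichotomy x t with h | rfl | h
    · have h' := (hf.slope_le_leftDeriv_of_mem_interior hx hti h).trans hlr
      rw [slope_def_field, div_le_iff₀ (by linarith)] at h'
      linarith
    · simp
    · have h' := hf.rightDeriv_le_slope_of_mem_interior hti hx h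
      rw [slope_def_field, le_div_iff₀ (by linarith)] at h'
      linarith
  refine ⟨m, ?_, ?_, hm⟩
  · have h1 := hA t ht
    have h2 := hm a ha
    nlinarith
  · have h1 := hB t ht
    have h2 := hm b hb
    nlinarith

namespace Yield

/-! ### The affine chart of the sector -/

/-- The shape function `g` in the affine chart `t = tan θ`: the radial function `r / g(θ)` on the
line `r cos θ = 1`. -/
noncomputable def chart (g : ℝ → ℝ) (t : ℝ) : ℝ := (cos (arctan t) * g (arctan t))⁻¹

/-- The derivative of `chart g` at `tan θ`, if `a` is the derivative of `g` at `θ`. -/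
noncomputable def chartSlope (g : ℝ → ℝ) (a θ : ℝ) : ℝ := sin θ / g θ - cos θ * a / g θ ^ 2

theorem hasDerivWithinAt_chart {g : ℝ → ℝ} {a t : ℝ} {s u : Set ℝ} (hg : g (arctan t) ≠ 0)
    (h : HasDerivWithinAt g a u (arctan t)) (hsu : MapsTo arctan s u) :
    HasDerivWithinAt (chart g) (chartSlope g a (arctan t)) s t := by
  have hc : cos (arctan t) ≠ 0 := (cos_arctan_pos t).ne'
  have h1 : HasDerivWithinAt (fun θ => (cos θ * g θ)⁻¹) _ u (arctan t) :=
    ((hasDerivAt_cos (arctan t)).hasDerivWithinAt.mul h).inv (mul_ne_zero hc hg)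
  have h2 := h1.comp t (hasDerivAt_arctan t).hasDerivWithinAt hsu
  refine h2.congr_deriv ?_
  have e : 1 / (1 + t ^ 2) = cos (arctan t) ^ 2 := (cos_sq_arctan t).symm
  rw [e, chartSlope]
  simp only [Pi.mul_apply]
  field_simp
  ring

theorem hasDerivAt_chart {g : ℝ → ℝ} {a t : ℝ} (hg : g (arctan t) ≠ 0)
    (h : HasDerivAt g a (arctan t)) :
    HasDerivAt (chart g) (chartSlope g a (arctan t)) t :=
  hasDerivWithinAt_univ.1 (hasDerivWithinAt_chart (u := univ) hg h.hasDerivWithinAt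
    (mapsTo_univ _ _))

theorem hasDerivAt_chartSlope {g : ℝ → ℝ} {θ : ℝ} (hg : g θ ≠ 0) (h : TwiceDiffAt g θ) :
    HasDerivAt (fun x => chartSlope g (deriv g x) x)
      (cos θ * (g θ ^ 2 + 2 * deriv g θ ^ 2 - g θ * deriv (deriv g) θ) / g θ ^ 3) θ := by
  have h1 : HasDerivAt g (deriv g θ) θ := h.1.self_of_nhds.hasDerivAt
  have h2 : HasDerivAt (deriv g) (deriv (deriv g) θ) θ := h.2.hasDerivAt
  have h3 : HasDerivAt (fun x => sin x / g x - cos x * deriv g x / g x ^ 2) _ θ :=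
    ((hasDerivAt_sin θ).div h1 hg).sub
    (((hasDerivAt_cos θ).mul h2).div (h1.pow 2) (pow_ne_zero 2 hg))
  refine h3.congr_deriv ?_
  simp only [Pi.mul_apply]
  field_simp
  ring

theorem hasDerivAt_chartSlope_arctan {g : ℝ → ℝ} {t : ℝ} (hg : g (arctan t) ≠ 0)
    (h : TwiceDiffAt g (arctan t)) :
    HasDerivAt (fun x => chartSlope g (deriv g (arctan x)) (arctan x))
      (cos (arctan t) * (g (arctan t) ^ 2 + 2 * deriv g (arctan t) ^ 2
        - g (arctan t) * deriv (deriv g) (arctan t)) / g (arctan t) ^ 3 * (1 / (1 + t ^ 2))) t :=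
  (hasDerivAt_chartSlope hg h).comp t (hasDerivAt_arctan t)

theorem arctan_mem_Icc {t : ℝ} (ht : t ∈ Icc 0 √3) : arctan t ∈ Icc 0 (π / 3) :=
  ⟨arctan_nonneg.2 ht.1, arctan_sqrt_three ▸ arctan_mono ht.2⟩

theorem arctan_mem_Ioo {t : ℝ} (ht : t ∈ Ioo 0 √3) : arctan t ∈ Ioo 0 (π / 3) :=
  ⟨arctan_pos.2 ht.1, arctan_sqrt_three ▸ arctan_strictMono ht.2⟩

/-- The chart contains the reciprocal of `g`, so the order of slopes is reversed. -/
theorem chartSlope_le_chartSlope {g : ℝ → ℝ} {a b θ : ℝ} (hc : 0 < cos θ) (hab : b ≤ a) :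
    chartSlope g a θ ≤ chartSlope g b θ := by
  unfold chartSlope
  gcongr

/-- The derivative conditions on `g` make `chart g` convex. -/
theorem convexOn_chart {g : ℝ → ℝ} (hcont : ContinuousOn g (Icc 0 (π / 3)))
    (hpos : ∀ θ ∈ Icc 0 (π / 3), 0 < g θ)
    (hfin : {θ ∈ Ioo 0 (π / 3) | ¬ TwiceDiffAt g θ}.Finite)
    (hdd : ∀ θ ∈ Ioo 0 (π / 3), TwiceDiffAt g θ →
      0 ≤ g θ ^ 2 + 2 * deriv g θ ^ 2 - g θ * deriv (deriv g) θ)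
    (hsing : ∀ θ ∈ singularPoints g, ∃ a b,
      HasDerivWithinAt g a (Iic θ) θ ∧ HasDerivWithinAt g b (Ici θ) θ ∧ b < a) :
    ConvexOn ℝ (Icc 0 √3) (chart g) := by
  have hg0 : ∀ t ∈ Icc 0 √3, g (arctan t) ≠ 0 := fun t ht => (hpos _ (arctan_mem_Icc ht)).ne'
  have hBmem : ∀ t ∈ Ioo 0 √3, t ∉ hfin.toFinset.image tan → TwiceDiffAt g (arctan t) := by
    intro t ht htB
    by_contra hcon
    exact htB (Finset.mem_image.2 ⟨arctan t,
      hfin.mem_toFinset.2 ⟨arctan_mem_Ioo ht, hcon⟩, tan_arctan t⟩)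
  refine convexOn_Icc_of_piecewise (f' := fun x => chartSlope g (deriv g (arctan x)) (arctan x))
    (f'' := deriv fun x => chartSlope g (deriv g (arctan x)) (arctan x))
    (hfin.toFinset.image tan) (by positivity) ?_ ?_ ?_
  · refine ContinuousOn.inv₀ ?_ fun t ht => mul_ne_zero (cos_arctan_pos t).ne' (hg0 t ht)
    refine (continuous_cos.comp continuous_arctan).continuousOn.mul ?_
    exact hcont.comp continuous_arctan.continuousOn fun t ht => arctan_mem_Icc ht
  · intro t ht htB
    have h2 := hBmem t ht htB
    have hp := hpos _ (arctan_mem_Icc (Ioo_subset_Icc_self ht))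
    have h := hasDerivAt_chartSlope_arctan hp.ne' h2
    refine ⟨hasDerivAt_chart hp.ne' h2.1.self_of_nhds.hasDerivAt,
      h.differentiableAt.hasDerivAt, ?_⟩
    rw [h.deriv]
    have := hdd _ (arctan_mem_Ioo ht) h2
    have := cos_arctan_pos t
    positivity
  · intro t ht _
    have hne := hg0 t (Ioo_subset_Icc_self ht)
    -- An exceptional point need not be singular: `g` may be differentiable there but not twice, and
    -- then the two slopes agree.
    by_cases hd : DifferentiableAt ℝ g (arctan t)
    · have h := hasDerivAt_chart hne hd.hasDerivAt
      exact ⟨_, _, h.hasDerivWithinAt, h.hasDerivWithinAt, le_rfl⟩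
    · obtain ⟨a, b, ha, hb, hab⟩ := hsing _ ⟨arctan_mem_Ioo ht, hd⟩
      exact ⟨_, _, hasDerivWithinAt_chart hne ha fun x hx => arctan_mono hx,
        hasDerivWithinAt_chart hne hb fun x hx => arctan_mono hx,
        chartSlope_le_chartSlope (cos_arctan_pos t) hab.le⟩

/-- Supporting lines of `chart g` whose linear extension to the deviatoric plane has ordered
coefficients. -/
theorem exists_supporting_line_chart {g : ℝ → ℝ} (hpos : ∀ θ ∈ Icc 0 (π / 3), 0 < g θ)
    (hconv : ConvexOn ℝ (Icc 0 √3) (chart g))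
    {a b : ℝ} (ha : HasDerivWithinAt g a (Ici 0) 0) (ha0 : a ≤ 0)
    (hb : HasDerivWithinAt g b (Iic (π / 3)) (π / 3)) (hb0 : 0 ≤ b) {t : ℝ} (ht : t ∈ Icc 0 √3) :
    ∃ m, 0 ≤ m ∧ m ≤ √3 * (chart g t - m * t) ∧
      ∀ x ∈ Icc 0 √3, chart g t + m * (x - t) ≤ chart g x := by
  have h3 : (0 : ℝ) < √3 := by positivity
  have h33 : √3 * √3 = 3 := mul_self_sqrt (by norm_num)
  have hpi : (0 : ℝ) ≤ π / 3 := by positivity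
  have hg0 := hpos 0 ⟨le_rfl, hpi⟩
  have hg3 := hpos (π / 3) ⟨hpi, le_rfl⟩
  have hr : HasDerivWithinAt (chart g) (chartSlope g a (arctan 0)) (Ici 0) 0 := by
    refine hasDerivWithinAt_chart (u := Ici 0) ?_ ?_ fun x hx => arctan_nonneg.2 hx <;>
      rw [arctan_zero]
    exacts [hg0.ne', ha]
  have hl : HasDerivWithinAt (chart g) (chartSlope g b (arctan √3)) (Iic √3) √3 := by
    refine hasDerivWithinAt_chart (u := Iic (π / 3)) ?_ ?_
      fun x hx => arctan_sqrt_three ▸ arctan_mono hx <;> rw [arctan_sqrt_three]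
    exacts [hg3.ne', hb]
  obtain ⟨m, hrm, hml, hm⟩ := hconv.exists_supporting_line_Icc h3 hr hl ht
  obtain ⟨M, hMr, hMl, hM⟩ := hconv.exists_supporting_line_Icc h3 hr hl ⟨h3.le, le_rfl⟩
  rw [arctan_zero, chartSlope] at hrm
  have hr0 : 0 ≤ m := by
    refine le_trans ?_ hrm
    simp only [sin_zero, zero_div, cos_zero, one_mul, zero_sub, Left.nonneg_neg_iff]
    exact div_nonpos_of_nonpos_of_nonneg ha0 (by positivity)
  -- At `t = √3` the bound `m ≤ √3 (chart g t - m t)` reads `4 m ≤ √3 chart g √3`; this is where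
  -- `g'(π/3) ≥ 0` enters.
  have hk : 4 * chartSlope g b (arctan √3) ≤ √3 * chart g √3 := by
    rw [chart, arctan_sqrt_three, chartSlope, sin_pi_div_three, cos_pi_div_three]
    have : 0 ≤ 1 / 2 * b / g (π / 3) ^ 2 := by positivity
    have e : √3 * (1 / 2 * g (π / 3))⁻¹ = 4 * (√3 / 2 / g (π / 3)) := by
      field_simp; ring
    linarith
  refine ⟨m, hr0, ?_, hm⟩
  have h1 := hm √3 ⟨h3.le, le_rfl⟩
  have h2 := hM t ht
  -- For `t < √3`, compare with the supporting line at `√3`: its slope `M` is at least `m`, and its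
  -- intercept at most that of the line at `t`.
  rcases ht.2.eq_or_lt with rfl | hlt
  · nlinarith
  · have hmM : m ≤ M := by
      by_contra! hlt'
      nlinarith [mul_pos (sub_pos.2 hlt') (sub_pos.2 hlt)]
    have h4 : chart g √3 - M * √3 ≤ chart g t - m * t := by
      nlinarith [mul_le_mul_of_nonneg_right hmM ht.1]
    nlinarith [mul_le_mul_of_nonneg_left h4 h3.le]

/-! ### Invariance and homogeneity on the space of principal stresses -/

/-- The function `q / g(θ)` on the Haigh-Westergaard space of principal stresses. -/
noncomputable def devStress (g : ℝ → ℝ) (s : Fin 3 → ℝ) : ℝ := devPart g (Matrix.diagonal s)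

theorem deviator_diagonal (s : Fin 3 → ℝ) :
    deviator (Matrix.diagonal s) = Matrix.diagonal fun i => s i - (∑ j, s j) / 3 := by
  rw [deviator, Matrix.trace_diagonal, ← Matrix.diagonal_one, ← Matrix.diagonal_smul,
    Matrix.diagonal_sub]
  simp

theorem J2_diagonal (s : Fin 3 → ℝ) :
    J2 (Matrix.diagonal s) = (∑ i, (s i - (∑ j, s j) / 3) ^ 2) / 2 := by
  rw [J2, deviator_diagonal, Matrix.diagonal_pow, Matrix.trace_diagonal]
  rfl

theorem J3_diagonal (s : Fin 3 → ℝ) :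
    J3 (Matrix.diagonal s) = (∑ i, (s i - (∑ j, s j) / 3) ^ 3) / 3 := by
  rw [J3, deviator_diagonal, Matrix.diagonal_pow, Matrix.trace_diagonal]
  rfl

theorem devPart_congr {g : ℝ → ℝ} {σ τ : Matrix (Fin 3) (Fin 3) ℝ} (h2 : J2 σ = J2 τ)
    (h3 : J3 σ = J3 τ) : devPart g σ = devPart g τ := by
  simp only [devPart, q, lode, h2, h3]

theorem devStress_comp_perm (g : ℝ → ℝ) (s : Fin 3 → ℝ) (e : Equiv.Perm (Fin 3)) :
    devStress g (s ∘ e) = devStress g s := by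
  have h1 : ∑ j, (s ∘ e) j = ∑ j, s j := Equiv.sum_comp e s
  refine devPart_congr ?_ ?_
  · rw [J2_diagonal, J2_diagonal, h1]
    exact congrArg (· / 2) (Equiv.sum_comp e fun i => (s i - (∑ j, s j) / 3) ^ 2)
  · rw [J3_diagonal, J3_diagonal, h1]
    exact congrArg (· / 3) (Equiv.sum_comp e fun i => (s i - (∑ j, s j) / 3) ^ 3)

theorem devStress_congr_of_sub_eq (g : ℝ → ℝ) {s s' : Fin 3 → ℝ} (c : ℝ)
    (h : ∀ i, s' i = s i + c) : devStress g s' = devStress g s := by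
  refine devPart_congr ?_ ?_
  · rw [J2_diagonal, J2_diagonal]
    simp only [Fin.sum_univ_three, h]
    ring
  · rw [J3_diagonal, J3_diagonal]
    simp only [Fin.sum_univ_three, h]
    ring

theorem lode_mem_Icc (σ : Matrix (Fin 3) (Fin 3) ℝ) : lode σ ∈ Icc 0 (π / 3) :=
  ⟨div_nonneg (arccos_nonneg _) (by norm_num), by unfold lode; gcongr; exact arccos_le_pi _⟩

theorem devStress_nonneg {g : ℝ → ℝ} (hpos : ∀ θ ∈ Icc 0 (π / 3), 0 < g θ) (s : Fin 3 → ℝ) :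
    0 ≤ devStress g s :=
  div_nonneg (sqrt_nonneg _) (hpos _ (lode_mem_Icc _)).le

theorem devStress_smul (g : ℝ → ℝ) {c : ℝ} (hc : 0 ≤ c) (s : Fin 3 → ℝ) :
    devStress g (c • s) = c * devStress g s := by
  have h2 : J2 (Matrix.diagonal (c • s)) = c ^ 2 * J2 (Matrix.diagonal s) := by
    simp only [J2_diagonal, Fin.sum_univ_three, Pi.smul_apply, smul_eq_mul]
    ring
  have h3 : J3 (Matrix.diagonal (c • s)) = c ^ 3 * J3 (Matrix.diagonal s) := by
    simp only [J3_diagonal, Fin.sum_univ_three, Pi.smul_apply, smul_eq_mul]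
    ring
  have hq : q (Matrix.diagonal (c • s)) = c * q (Matrix.diagonal s) := by
    rw [q, q, h2, show 3 * (c ^ 2 * J2 (Matrix.diagonal s)) = c ^ 2 * (3 * J2 (Matrix.diagonal s))
      by ring, sqrt_mul (sq_nonneg c), sqrt_sq hc]
  rcases hc.eq_or_lt with rfl | hc0
  · rw [devStress, devPart, hq, zero_mul, zero_div, zero_mul]
  have hl : lode (Matrix.diagonal (c • s)) = lode (Matrix.diagonal s) := by
    have hJ : 0 ≤ J2 (Matrix.diagonal s) := by
      rw [J2_diagonal]; positivity
    have e : (c ^ 2) ^ (3 / 2 : ℝ) = c ^ 3 := by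
      rw [← rpow_natCast c 2, ← rpow_mul hc, ← rpow_natCast c 3]
      norm_num
    rw [lode, lode, h2, h3, mul_rpow (sq_nonneg c) hJ, e, mul_div_mul_left _ _ (by positivity)]
  rw [devStress, devPart, hq, hl, mul_div_assoc]
  rfl

/-! ### Polar coordinates in the deviatoric plane -/

/-- The coordinate of the stress `s` in the deviatoric plane along the direction of Lode angle
zero, scaled so that `q` is the Euclidean norm. -/
noncomputable def xCoord (s : Fin 3 → ℝ) : ℝ := (2 * s 2 - s 1 - s 0) / 2

/-- The coordinate of the stress `s` in the deviatoric plane orthogonal to the direction of Lode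
angle zero, scaled so that `q` is the Euclidean norm. -/
noncomputable def yCoord (s : Fin 3 → ℝ) : ℝ := √3 / 2 * (s 1 - s 0)

theorem J2_diagonal_eq_coord (s : Fin 3 → ℝ) :
    J2 (Matrix.diagonal s) = (xCoord s ^ 2 + yCoord s ^ 2) / 3 := by
  have h : √3 ^ 2 = 3 := sq_sqrt (by norm_num)
  rw [J2_diagonal, xCoord, yCoord, mul_pow, div_pow, div_pow, h]
  simp only [Fin.sum_univ_three]
  ring

theorem J3_diagonal_eq_coord (s : Fin 3 → ℝ) :
    J3 (Matrix.diagonal s) = 2 / 27 * (xCoord s ^ 3 - 3 * xCoord s * yCoord s ^ 2) := by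
  have h : √3 ^ 2 = 3 := sq_sqrt (by norm_num)
  rw [J3_diagonal, xCoord, yCoord, mul_pow, div_pow, div_pow, h]
  simp only [Fin.sum_univ_three]
  ring

/-- Since `x³ - 3xy² = r³ cos 3φ`, the arccosine is applied to `cos 3φ`, and it returns `3φ` because
`3φ ∈ [0, π]`. -/
theorem devStress_of_polar (g : ℝ → ℝ) {s : Fin 3 → ℝ} {r φ : ℝ} (hr : 0 ≤ r)
    (hφ : φ ∈ Icc 0 (π / 3)) (hx : xCoord s = r * cos φ) (hy : yCoord s = r * sin φ) :
    devStress g s = r / g φ := by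
  have hJ2 : J2 (Matrix.diagonal s) = r ^ 2 / 3 := by
    rw [J2_diagonal_eq_coord, hx, hy]
    linear_combination (r ^ 2 / 3) * sin_sq_add_cos_sq φ
  have hq : q (Matrix.diagonal s) = r := by
    rw [q, hJ2, mul_div_cancel₀ _ (by norm_num), sqrt_sq hr]
  rcases hr.eq_or_lt with rfl | hr0
  · rw [devStress, devPart, hq, zero_div, zero_div]
  have hJ3 : J3 (Matrix.diagonal s) = 2 / 27 * r ^ 3 * cos (3 * φ) := by
    rw [J3_diagonal_eq_coord, hx, hy, cos_three_mul]
    linear_combination (-(6 / 27) * r ^ 3 * cos φ) * sin_sq_add_cos_sq φ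
  have h3 : √3 ^ 2 = 3 := sq_sqrt (by norm_num)
  have hpow : (r ^ 2 / 3) ^ (3 / 2 : ℝ) = (r / √3) ^ 3 := by
    have e : r ^ 2 / 3 = (r / √3) ^ 2 := by rw [div_pow, h3]
    rw [e, ← rpow_natCast _ 2, ← rpow_mul (by positivity), ← rpow_natCast _ 3]
    norm_num
  have hl : lode (Matrix.diagonal s) = φ := by
    have e : 3 * √3 / 2 * (2 / 27 * r ^ 3 * cos (3 * φ) / (r / √3) ^ 3) = cos (3 * φ) := by
      have h4 : √3 ^ 4 = 9 := by rw [show √3 ^ 4 = (√3 ^ 2) ^ 2 by ring, h3]; norm_num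
      field_simp
      linear_combination 3 * cos (3 * φ) * h4
    rw [lode, hJ2, hJ3, hpow, e, arccos_cos (by linarith [hφ.1]) (by linarith [hφ.2])]
    ring
  rw [devStress, devPart, hq, hl]

/-- In the sector of ordered stresses, `devStress g` is the perspective of `chart g`. -/
theorem devStress_eq_chart (g : ℝ → ℝ) {s : Fin 3 → ℝ} (hx : 0 < xCoord s)
    (ht : yCoord s / xCoord s ∈ Icc 0 √3) :
    devStress g s = xCoord s * chart g (yCoord s / xCoord s) := by
  set t := yCoord s / xCoord s with ht'
  have hc := cos_arctan_pos t
  have h := devStress_of_polar g (r := xCoord s / cos (arctan t)) (by positivity)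
    (arctan_mem_Icc ht) (s := s) (by field_simp) (by
      rw [div_mul_eq_mul_div, mul_div_assoc, ← tan_eq_sin_div_cos, tan_arctan, ht']
      field_simp)
  rw [h, chart]
  field_simp

theorem yCoord_div_xCoord_mem_Icc {s : Fin 3 → ℝ} (hs : Monotone s) (hx : 0 < xCoord s) :
    yCoord s / xCoord s ∈ Icc 0 √3 := by
  have h01 : s 0 ≤ s 1 := hs (by decide)
  have h12 : s 1 ≤ s 2 := hs (by decide)
  refine ⟨div_nonneg (mul_nonneg (by positivity) (by linarith)) hx.le, ?_⟩
  rw [div_le_iff₀ hx, xCoord, yCoord]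
  nlinarith [sqrt_nonneg 3]

theorem xCoord_nonneg {s : Fin 3 → ℝ} (hs : Monotone s) : 0 ≤ xCoord s := by
  have h01 : s 0 ≤ s 1 := hs (by decide)
  have h12 : s 1 ≤ s 2 := hs (by decide)
  unfold xCoord
  linarith

theorem devStress_eq_zero (g : ℝ → ℝ) {s : Fin 3 → ℝ} (hs : Monotone s) (hx : xCoord s = 0) :
    devStress g s = 0 := by
  have h01 : s 0 ≤ s 1 := hs (by decide)
  have h12 : s 1 ≤ s 2 := hs (by decide)
  have hy : yCoord s = 0 := by
    have : s 1 = s 0 := by unfold xCoord at hx; linarith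
    simp [yCoord, this]
  simpa using devStress_of_polar g (r := 0) le_rfl ⟨le_rfl, by positivity⟩ (by simpa) (by simpa)

/-! ### Supporting functionals and rearrangement -/

/-- At an ordered stress, `devStress g` has a supporting functional, among ordered stresses, with
ordered coefficients. -/
theorem exists_monotone_supporting_functional {g : ℝ → ℝ}
    (hsup : ∀ t ∈ Icc 0 √3, ∃ m, 0 ≤ m ∧ m ≤ √3 * (chart g t - m * t) ∧
      ∀ x ∈ Icc 0 √3, chart g t + m * (x - t) ≤ chart g x)
    (hpos : ∀ θ ∈ Icc 0 (π / 3), 0 < g θ) {s : Fin 3 → ℝ} (hs : Monotone s) :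
    ∃ c : Fin 3 → ℝ, Monotone c ∧ devStress g s = ∑ i, s i * c i ∧
      ∀ u : Fin 3 → ℝ, Monotone u → ∑ i, u i * c i ≤ devStress g u := by
  rcases (xCoord_nonneg hs).eq_or_lt with hx | hx
  · exact ⟨0, monotone_const, by simp [devStress_eq_zero g hs hx.symm],
      fun u _ => by simpa using devStress_nonneg hpos u⟩
  have ht := yCoord_div_xCoord_mem_Icc hs hx
  obtain ⟨m, hm0, hmA, hm⟩ := hsup _ ht
  have hN := devStress_eq_chart g hx ht
  set t := yCoord s / xCoord s
  have hy : yCoord s = t * xCoord s := (div_mul_cancel₀ _ hx.ne').symm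
  set A := chart g t - m * t with hA
  have h33 : √3 * √3 = 3 := mul_self_sqrt (by norm_num)
  -- These are the coefficients of `A x + m y` in the principal stresses; they are ordered exactly
  -- when `0 ≤ m` and `m ≤ √3 A`.
  have hlin : ∀ u : Fin 3 → ℝ,
      ∑ i, u i * ![-A / 2 - √3 / 2 * m, -A / 2 + √3 / 2 * m, A] i
        = A * xCoord u + m * yCoord u := by
    intro u
    simp only [Fin.sum_univ_three, xCoord, yCoord, Matrix.cons_val]
    ring
  refine ⟨![-A / 2 - √3 / 2 * m, -A / 2 + √3 / 2 * m, A], ?_, ?_, ?_⟩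
  · have h3 := sqrt_nonneg 3
    refine Fin.monotone_iff_le_succ.2 fun i => ?_
    fin_cases i
    · simp only [Fin.zero_eta, Fin.castSucc_zero, Matrix.cons_val_zero, Fin.succ_zero_eq_one,
        Matrix.cons_val_one]
      nlinarith [mul_nonneg h3 hm0]
    · change -A / 2 + √3 / 2 * m ≤ A
      have h := mul_le_mul_of_nonneg_left hmA h3
      rw [← mul_assoc, h33] at h
      linarith
  · rw [hlin, hN, hy, hA]
    ring
  · intro u hu
    rw [hlin]
    rcases (xCoord_nonneg hu).eq_or_lt with hxu | hxu
    · have h01 : u 0 ≤ u 1 := hu (by decide)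
      have h12 : u 1 ≤ u 2 := hu (by decide)
      have : u 1 = u 0 := by unfold xCoord at hxu; linarith
      rw [devStress_eq_zero g hu hxu.symm, ← hxu, yCoord, this]
      simp
    · have htu := yCoord_div_xCoord_mem_Icc hu hxu
      rw [devStress_eq_chart g hxu htu]
      have h := mul_le_mul_of_nonneg_left (hm _ htu) hxu.le
      have e : xCoord u * (yCoord u / xCoord u) = yCoord u := mul_div_cancel₀ _ hxu.ne'
      refine le_trans (le_of_eq ?_) h
      rw [hA]
      linear_combination -m * e

theorem convexOn_devStress {g : ℝ → ℝ} (hpos : ∀ θ ∈ Icc 0 (π / 3), 0 < g θ)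
    (hsup : ∀ t ∈ Icc 0 √3, ∃ m, 0 ≤ m ∧ m ≤ √3 * (chart g t - m * t) ∧
      ∀ x ∈ Icc 0 √3, chart g t + m * (x - t) ≤ chart g x) :
    ConvexOn ℝ univ (devStress g) := by
  refine ⟨convex_univ, fun s _ s' _ a b ha hb _ => ?_⟩
  set w := a • s + b • s' with hw
  obtain ⟨c, hc, hcw, hcu⟩ :=
    exists_monotone_supporting_functional hsup hpos (Tuple.monotone_sort w)
  have hall : ∀ u : Fin 3 → ℝ, ∑ i, u i * c i ≤ devStress g u := by
    intro u
    have h1 := hcu _ (Tuple.monotone_sort u)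
    -- Rearrangement: against ordered coefficients, sorting `u` can only increase the sum.
    have h2 := ((Tuple.monotone_sort u).monovary hc).sum_comp_perm_mul_le_sum_mul
      (σ := (Tuple.sort u)⁻¹)
    rw [devStress_comp_perm] at h1
    simpa using h2.trans h1
  -- The permutation sorting `w` is applied to `s` and `s'` too, which keeps the combination linear;
  -- they need not become ordered, hence `hall`.
  set e := Tuple.sort w
  have h1 := mul_le_mul_of_nonneg_left (hall (s ∘ e)) ha
  have h2 := mul_le_mul_of_nonneg_left (hall (s' ∘ e)) hb
  rw [devStress_comp_perm] at h1 h2 hcw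
  rw [hcw, smul_eq_mul, smul_eq_mul]
  refine le_trans (le_of_eq ?_) (add_le_add h1 h2)
  rw [Finset.mul_sum, Finset.mul_sum, ← Finset.sum_add_distrib]
  refine Finset.sum_congr rfl fun i _ => ?_
  simp only [hw, Function.comp_apply, Pi.add_apply, Pi.smul_apply, smul_eq_mul]
  ring

/-! ### Equivalent forms of convexity -/

theorem convexOn_devFun_iff {g : ℝ → ℝ} :
    ConvexOn ℝ univ (devFun g) ↔ ConvexOn ℝ univ (devStress g) := by
  constructor <;> intro h
  · have e : ∀ s, devStress g s
        = devFun g (s 0 - (s 0 + s 1 + s 2) / 3, s 1 - (s 0 + s 1 + s 2) / 3) := by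
      intro s
      refine (devStress_congr_of_sub_eq g (-((s 0 + s 1 + s 2) / 3)) fun i => ?_).symm
      fin_cases i <;> simp <;> ring
    refine ⟨convex_univ, fun s _ s' _ a b ha hb hab => ?_⟩
    rw [e, e, e]
    refine le_trans (le_of_eq (congrArg _ ?_)) (h.2 (mem_univ _) (mem_univ _) ha hb hab)
    ext <;> simp <;> ring
  · refine ⟨convex_univ, fun S _ S' _ a b ha hb hab => ?_⟩
    refine le_trans (le_of_eq (congrArg (devStress g) ?_))
      (h.2 (mem_univ _) (mem_univ _) ha hb hab)
    funext i
    fin_cases i <;> simp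
    ring

theorem mem_devSection {g : ℝ → ℝ} {p k : ℝ} {s : Fin 3 → ℝ} :
    s ∈ devSection g p k ↔ s 0 + s 1 + s 2 = -3 * p ∧ devStress g s ≤ k := by
  rw [devSection, mem_ofPred_eq, pressure, Matrix.trace_diagonal, Fin.sum_univ_three]
  refine and_congr_left fun _ => ?_
  constructor <;> intro h <;> linarith

theorem convex_devSection_iff {g : ℝ → ℝ} (hpos : ∀ θ ∈ Icc 0 (π / 3), 0 < g θ) (p : ℝ) {k : ℝ}
    (hk : 0 < k) : Convex ℝ (devSection g p k) ↔ ConvexOn ℝ univ (devStress g) := by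
  constructor <;> intro h
  · have hadd : ∀ s s' : Fin 3 → ℝ, devStress g (s + s') ≤ devStress g s + devStress g s' := by
      intro s s'
      refine le_of_forall_pos_le_add fun ε hε => ?_
      -- The levels may vanish on the hydrostatic axis; `ε / 2` makes them positive divisors.
      obtain ⟨α, hα⟩ : ∃ α, α = devStress g s + ε / 2 := ⟨_, rfl⟩
      obtain ⟨β, hβ⟩ : ∃ β, β = devStress g s' + ε / 2 := ⟨_, rfl⟩
      have hs := devStress_nonneg hpos s
      have hs' := devStress_nonneg hpos s'
      have hα0 : 0 < α := by linarith
      have hβ0 : 0 < β := by linarith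
      -- Scaling by `k / γ` brings `u` to level at most `k`, and a hydrostatic shift brings it to
      -- pressure `p`. Weights proportional to `α` and `β` then turn the convex combination into a
      -- shifted multiple of `s + s'`.
      have key : ∀ (u : Fin 3 → ℝ) (γ : ℝ), 0 < γ → devStress g u ≤ γ →
          (fun i => (k / γ) * u i + (-p - k / γ * (u 0 + u 1 + u 2) / 3)) ∈ devSection g p k := by
        intro u γ hγ hu
        refine mem_devSection.2 ⟨by ring, ?_⟩
        refine (devStress_congr_of_sub_eq g (s := (k / γ) • u)
          (-p - k / γ * (u 0 + u 1 + u 2) / 3) fun i => rfl).trans_le ?_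
        rw [devStress_smul g (by positivity), div_mul_eq_mul_div, div_le_iff₀ hγ]
        gcongr
      have hc := (mem_devSection.1 (h (key s α hα0 (by linarith)) (key s' β hβ0 (by linarith))
        (a := α / (α + β)) (b := β / (α + β)) (by positivity) (by positivity)
        (by field_simp))).2
      rw [devStress_congr_of_sub_eq g (s := (k / (α + β)) • (s + s'))
        (-p - k / (α + β) * (s 0 + s 1 + s 2 + (s' 0 + s' 1 + s' 2)) / 3) fun i => by
          simp only [Pi.add_apply, Pi.smul_apply, smul_eq_mul]
          field_simp
          ring,
        devStress_smul g (by positivity), div_mul_eq_mul_div, div_le_iff₀ (by positivity)] at hc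
      have := le_of_mul_le_mul_left hc hk
      linarith
    refine ⟨convex_univ, fun s _ s' _ a b ha hb _ => (hadd _ _).trans (le_of_eq ?_)⟩
    rw [devStress_smul g ha, devStress_smul g hb]
    rfl
  · intro s hs s' hs' a b ha hb hab
    rw [mem_devSection] at *
    refine ⟨?_, ?_⟩
    · simp only [Pi.add_apply, Pi.smul_apply, smul_eq_mul]
      linear_combination a * hs.1 + b * hs'.1 + (-3 * p) * hab
    · have h1 := h.2 (mem_univ s) (mem_univ s') ha hb hab
      rw [smul_eq_mul, smul_eq_mul] at h1
      have h2 := mul_le_mul_of_nonneg_left hs.2 ha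
      have h3 := mul_le_mul_of_nonneg_left hs'.2 hb
      have : a * k + b * k = k := by rw [← add_mul, hab, one_mul]
      linarith

end Yield

/-! ### Necessity of the derivative conditions -/

/-- A one-sided lower bound by a line bounds the right derivative from below. -/
theorem HasDerivWithinAt.le_of_forall_ge_line {f : ℝ → ℝ} {f' m x : ℝ}
    (h : HasDerivWithinAt f f' (Ioi x) x) (hm : ∀ y, x < y → f x + m * (y - x) ≤ f y) :
    m ≤ f' := by
  refine ge_of_tendsto ((hasDerivWithinAt_iff_tendsto_slope' self_notMem_Ioi).1 h) ?_
  filter_upwards [self_mem_nhdsWithin] with y hy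
  have hy' : x < y := hy
  rw [slope_def_field, le_div_iff₀ (by linarith)]
  linarith [hm y hy']

/-- A one-sided lower bound by a line bounds the left derivative from above. -/
theorem HasDerivWithinAt.ge_of_forall_ge_line {f : ℝ → ℝ} {f' m x : ℝ}
    (h : HasDerivWithinAt f f' (Iio x) x) (hm : ∀ y, y < x → f x + m * (y - x) ≤ f y) :
    f' ≤ m := by
  refine le_of_tendsto ((hasDerivWithinAt_iff_tendsto_slope' self_notMem_Iio).1 h) ?_
  filter_upwards [self_mem_nhdsWithin] with y hy
  have hy' : y < x := hy
  rw [slope_def_field, div_le_iff_of_neg (by linarith)]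
  linarith [hm y hy']

namespace Yield

/-- The line `r cos θ = 1` in the deviatoric plane. -/
noncomputable def chartLine (t : ℝ) : Fin 3 → ℝ := ![-1 / 3 - t / √3, -1 / 3 + t / √3, 2 / 3]

theorem xCoord_chartLine (t : ℝ) : xCoord (chartLine t) = 1 := by
  simp only [xCoord, chartLine, Matrix.cons_val]
  ring

theorem yCoord_chartLine (t : ℝ) : yCoord (chartLine t) = t := by
  simp only [yCoord, chartLine, Matrix.cons_val]
  field_simp
  ring

theorem devStress_chartLine (g : ℝ → ℝ) {t : ℝ} (ht : t ∈ Icc 0 √3) :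
    devStress g (chartLine t) = chart g t := by
  have h := devStress_eq_chart g (s := chartLine t) (by rw [xCoord_chartLine]; exact one_pos)
    (by rwa [xCoord_chartLine, yCoord_chartLine, div_one])
  rwa [xCoord_chartLine, yCoord_chartLine, div_one, one_mul] at h

/-- Convexity on all of `ℝ`, beyond `[0, √3]` where the function is `chart g`, provides one-sided
derivatives at `0` and `√3` as well. -/
theorem convexOn_devStress_chartLine {g : ℝ → ℝ} (h : ConvexOn ℝ univ (devStress g)) :
    ConvexOn ℝ univ fun t => devStress g (chartLine t) := by
  refine ⟨convex_univ, fun t _ t' _ a b ha hb hab => ?_⟩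
  refine le_trans (le_of_eq (congrArg (devStress g) ?_)) (h.2 (mem_univ _) (mem_univ _) ha hb hab)
  funext i
  fin_cases i <;> simp [chartLine]
  · linear_combination (1 / 3) * hab
  · linear_combination (1 / 3) * hab
  · linear_combination (-2 / 3) * hab

theorem devStress_midpoint_swap_le {g : ℝ → ℝ} (h : ConvexOn ℝ univ (devStress g))
    (s : Fin 3 → ℝ) (i j : Fin 3) :
    devStress g ((1 / 2 : ℝ) • s + (1 / 2 : ℝ) • (s ∘ Equiv.swap i j)) ≤ devStress g s := by
  have := h.2 (mem_univ s) (mem_univ (s ∘ Equiv.swap i j))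
    (show (0 : ℝ) ≤ 1 / 2 by norm_num) (show (0 : ℝ) ≤ 1 / 2 by norm_num) (by norm_num)
  rw [devStress_comp_perm, smul_eq_mul] at this
  linarith

/-- The midpoint of `chartLine t` and its mirror image in the wall `θ = 0` is `chartLine 0`. -/
theorem devStress_chartLine_zero_le {g : ℝ → ℝ} (h : ConvexOn ℝ univ (devStress g)) (t : ℝ) :
    devStress g (chartLine 0) ≤ devStress g (chartLine t) := by
  refine le_trans (le_of_eq (congrArg (devStress g) ?_)) (devStress_midpoint_swap_le h _ 0 1)
  funext i
  fin_cases i <;> simp [chartLine] <;> ring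

/-- Reflection in the wall `θ = π/3` leaves the line, but the midpoint is still on the ray of
`chartLine √3`, with factor `(1 + √3 t) / 4`. When the factor is negative, nonnegativity suffices.
-/
theorem devStress_chartLine_sqrt_three_le {g : ℝ → ℝ} (hpos : ∀ θ ∈ Icc 0 (π / 3), 0 < g θ)
    (h : ConvexOn ℝ univ (devStress g)) (t : ℝ) :
    (1 + √3 * t) / 4 * devStress g (chartLine √3) ≤ devStress g (chartLine t) := by
  have hK := devStress_nonneg hpos (chartLine √3)
  rcases le_or_gt 0 (1 + √3 * t) with h0 | h0
  · have h33 : √3 * √3 = 3 := mul_self_sqrt (by norm_num)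
    rw [← devStress_smul g (by positivity)]
    refine le_trans (le_of_eq (congrArg (devStress g) ?_)) (devStress_midpoint_swap_le h _ 1 2)
    have e : t / √3 = √3 * t / 3 := by field_simp; linear_combination -t * h33
    funext i
    fin_cases i <;> simp [chartLine, Equiv.swap_apply_of_ne_of_ne, e] <;> ring
  · exact (mul_nonpos_of_nonpos_of_nonneg (by linarith) hK).trans (devStress_nonneg hpos _)

theorem tan_mem_Icc {θ : ℝ} (h : θ ∈ Icc 0 (π / 3)) : tan θ ∈ Icc 0 √3 := by
  have := pi_pos
  rw [← tan_pi_div_three]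
  refine ⟨tan_nonneg_of_nonneg_of_le_pi_div_two h.1 (by linarith [h.2]), ?_⟩
  exact strictMonoOn_tan.monotoneOn ⟨by linarith [h.1], by linarith [h.2]⟩
    ⟨by linarith, by linarith⟩ h.2

theorem cos_pos_of_mem {θ : ℝ} (h : θ ∈ Icc 0 (π / 3)) : 0 < cos θ :=
  cos_pos_of_mem_Ioo ⟨by linarith [h.1, pi_pos], by linarith [h.2, pi_pos]⟩

/-- One-sided derivatives of the radial function on the chart give those of `g`. -/
theorem hasDerivWithinAt_of_chartLine {g : ℝ → ℝ} (hpos : ∀ θ ∈ Icc 0 (π / 3), 0 < g θ)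
    {κ θ : ℝ} {s u : Set ℝ} (hθ : θ ∈ s) (hs : s ⊆ Icc 0 (π / 3))
    (h : HasDerivWithinAt (fun t => devStress g (chartLine t)) κ u (tan θ))
    (hsu : MapsTo tan s u) :
    HasDerivWithinAt g ((sin θ / g θ - κ) * (g θ ^ 2 / cos θ)) s θ := by
  have hg : ∀ x ∈ s, g x = (cos x * devStress g (chartLine (tan x)))⁻¹ := by
    intro x hx
    have hc := cos_pos_of_mem (hs hx)
    have hp := hpos x (hs hx)
    rw [devStress_chartLine g (tan_mem_Icc (hs hx)), chart,
      arctan_tan (by linarith [(hs hx).1, pi_pos]) (by linarith [(hs hx).2, pi_pos])]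
    field_simp
  have hc := cos_pos_of_mem (hs hθ)
  have hp := hpos θ (hs hθ)
  have hK : devStress g (chartLine (tan θ)) = (cos θ * g θ)⁻¹ := by
    rw [hg θ hθ]
    field_simp
  have h1 := h.comp θ (hasDerivAt_tan hc.ne').hasDerivWithinAt hsu
  have h2 := ((hasDerivAt_cos θ).hasDerivWithinAt.mul h1).inv (by
    change cos θ * devStress g (chartLine (tan θ)) ≠ 0
    rw [hK]
    positivity)
  refine (h2.congr_of_mem (fun x hx => ?_) hθ).congr_deriv ?_
  · rw [hg x hx]
    rfl
  · simp only [Pi.mul_apply, Function.comp_apply, hK]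
    field_simp
    ring

theorem hasDerivWithinAt_Ici_of_chartLine {g : ℝ → ℝ}
    (hpos : ∀ θ ∈ Icc 0 (π / 3), 0 < g θ) {κ θ : ℝ}
    (hθ : θ ∈ Ico 0 (π / 3))
    (h : HasDerivWithinAt (fun t => devStress g (chartLine t)) κ (Ioi (tan θ)) (tan θ)) :
    HasDerivWithinAt g ((sin θ / g θ - κ) * (g θ ^ 2 / cos θ)) (Ici θ) θ := by
  refine (hasDerivWithinAt_of_chartLine hpos (s := Icc θ (π / 3)) ⟨le_rfl, hθ.2.le⟩
    (Icc_subset_Icc_left hθ.1) h.Ici_of_Ioi fun x hx => ?_).mono_of_mem_nhdsWithin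
      (Icc_mem_nhdsGE hθ.2)
  have := pi_pos
  exact strictMonoOn_tan.monotoneOn ⟨by linarith [hθ.1], by linarith [hθ.2]⟩
    ⟨by linarith [hθ.1, hx.1], by linarith [hx.2]⟩ hx.1

theorem hasDerivWithinAt_Iic_of_chartLine {g : ℝ → ℝ}
    (hpos : ∀ θ ∈ Icc 0 (π / 3), 0 < g θ) {κ θ : ℝ}
    (hθ : θ ∈ Ioc 0 (π / 3))
    (h : HasDerivWithinAt (fun t => devStress g (chartLine t)) κ (Iio (tan θ)) (tan θ)) :
    HasDerivWithinAt g ((sin θ / g θ - κ) * (g θ ^ 2 / cos θ)) (Iic θ) θ := by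
  refine (hasDerivWithinAt_of_chartLine hpos (s := Icc 0 θ) ⟨hθ.1.le, le_rfl⟩
    (Icc_subset_Icc_right hθ.2) h.Iic_of_Iio fun x hx => ?_).mono_of_mem_nhdsWithin
      (Icc_mem_nhdsLE hθ.1)
  have := pi_pos
  exact strictMonoOn_tan.monotoneOn ⟨by linarith [hx.1], by linarith [hx.2, hθ.2]⟩
    ⟨by linarith [hθ.1], by linarith [hθ.2]⟩ hx.2

theorem second_order_condition_of_convexOn {g : ℝ → ℝ} (hpos : ∀ θ ∈ Icc 0 (π / 3), 0 < g θ)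
    (h : ConvexOn ℝ univ (devStress g)) {θ : ℝ} (hθ : θ ∈ Ioo 0 (π / 3))
    (h2 : TwiceDiffAt g θ) :
    0 ≤ g θ ^ 2 + 2 * deriv g θ ^ 2 - g θ * deriv (deriv g) θ := by
  have hpi := pi_pos
  have hK := convexOn_devStress_chartLine h
  have hat : arctan (tan θ) = θ := arctan_tan (by linarith [hθ.1]) (by linarith [hθ.2])
  have hev : ∀ᶠ t in nhds (tan θ), arctan t ∈ Ioo 0 (π / 3) ∧ DifferentiableAt ℝ g (arctan t) := by
    refine (continuous_arctan.tendsto (tan θ)).eventually (p := fun x => x ∈ Ioo 0 (π / 3) ∧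
      DifferentiableAt ℝ g x) ?_
    rw [hat]
    exact (isOpen_Ioo.eventually_mem hθ).and h2.1
  have hder : ∀ᶠ t in nhds (tan θ), HasDerivAt (fun t => devStress g (chartLine t))
      (chartSlope g (deriv g (arctan t)) (arctan t)) t := by
    filter_upwards [hev.eventually_nhds] with t ht
    have h0 := ht.self_of_nhds
    refine (hasDerivAt_chart (hpos _ (Ioo_subset_Icc_self h0.1)).ne'
      h0.2.hasDerivAt).congr_of_eventuallyEq ?_
    filter_upwards [ht] with x hx
    refine devStress_chartLine g ?_
    rw [← tan_arctan x]
    exact tan_mem_Icc (Ioo_subset_Icc_self hx.1)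
  obtain ⟨ε, hε, hball⟩ := Metric.eventually_nhds_iff_ball.1 hder
  -- Near `tan θ` the slope of a convex function is monotone, so its derivative, a positive multiple
  -- of the wanted expression, is nonnegative.
  have hmono : MonotoneOn (fun t => chartSlope g (deriv g (arctan t)) (arctan t))
      (Metric.ball (tan θ) ε) := by
    refine ((hK.subset (subset_univ _) (convex_ball _ _)).monotoneOn_deriv
      fun x hx => (hball x hx).differentiableAt).congr fun x hx => (hball x hx).deriv
  have hp := hpos θ (Ioo_subset_Icc_self hθ)
  have hd := hasDerivAt_chartSlope_arctan (g := g) (t := tan θ) (by rw [hat]; exact hp.ne')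
    (by rwa [hat])
  have hacc := PerfectSpace.univ_preperfect.open_inter
    (Metric.isOpen_ball (x := tan θ) (ε := ε)) (tan θ) ⟨Metric.mem_ball_self hε, mem_univ _⟩
  rw [inter_univ] at hacc
  have hnn := hd.hasDerivWithinAt.nonneg_of_monotoneOn
    hacc hmono
  rw [hat] at hnn
  by_contra! hneg
  have hc := cos_pos_of_mem (Ioo_subset_Icc_self hθ)
  refine hnn.not_gt (mul_neg_of_neg_of_pos (div_neg_of_neg_of_pos
    (mul_neg_of_pos_of_neg hc hneg) (by positivity)) (by positivity))

theorem conditions_of_convexOn {g : ℝ → ℝ} (hpos : ∀ θ ∈ Icc 0 (π / 3), 0 < g θ)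
    (h : ConvexOn ℝ univ (devStress g)) :
    (∀ θ ∈ Ioo 0 (π / 3), TwiceDiffAt g θ →
        0 ≤ g θ ^ 2 + 2 * deriv g θ ^ 2 - g θ * deriv (deriv g) θ) ∧
      (∃ a, HasDerivWithinAt g a (Ici 0) 0 ∧ a ≤ 0) ∧
      (∃ b, HasDerivWithinAt g b (Iic (π / 3)) (π / 3) ∧ 0 ≤ b) ∧
      (∀ θ ∈ singularPoints g, ∃ a b,
        HasDerivWithinAt g a (Iic θ) θ ∧ HasDerivWithinAt g b (Ici θ) θ ∧ b < a) := by
  have hpi := pi_pos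
  have hK := convexOn_devStress_chartLine h
  have hi : ∀ t : ℝ, t ∈ interior univ := fun t => by simp
  have hR := fun t => hK.hasDerivWithinAt_rightDeriv_of_mem_interior (hi t)
  have hL := fun t => hK.hasDerivWithinAt_leftDeriv_of_mem_interior (hi t)
  refine ⟨fun θ hθ h2 => second_order_condition_of_convexOn hpos h hθ h2,
    ⟨_, hasDerivWithinAt_Ici_of_chartLine hpos ⟨le_rfl, by positivity⟩ (hR _), ?_⟩,
    ⟨_, hasDerivWithinAt_Iic_of_chartLine hpos ⟨by positivity, le_rfl⟩ (hL _), ?_⟩, fun θ hθ => ?_⟩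
  · have h0 := (hR 0).le_of_forall_ge_line (m := 0) fun y _ => by
      simpa using devStress_chartLine_zero_le h y
    rw [sin_zero, zero_div, cos_zero, tan_zero]
    exact mul_nonpos_of_nonpos_of_nonneg (by linarith) (by positivity)
  · have hp := hpos (π / 3) ⟨by positivity, le_rfl⟩
    have h33 : √3 * √3 = 3 := mul_self_sqrt (by norm_num)
    have h3 := (hL √3).ge_of_forall_ge_line (m := √3 / 4 * devStress g (chartLine √3))
      fun y _ => by
        refine le_trans (le_of_eq ?_) (devStress_chartLine_sqrt_three_le hpos h y)
        linear_combination (-1 / 4 * devStress g (chartLine √3)) * h33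
    rw [devStress_chartLine g ⟨by positivity, le_rfl⟩, chart, arctan_sqrt_three,
      cos_pi_div_three] at h3
    rw [sin_pi_div_three, cos_pi_div_three, tan_pi_div_three]
    refine mul_nonneg (sub_nonneg.2 (h3.trans (le_of_eq ?_))) (by positivity)
    field_simp
    norm_num
  · have hl := hasDerivWithinAt_Iic_of_chartLine hpos ⟨hθ.1.1, hθ.1.2.le⟩ (hL (tan θ))
    have hr := hasDerivWithinAt_Ici_of_chartLine hpos ⟨hθ.1.1.le, hθ.1.2⟩ (hR (tan θ))
    -- Convexity gives only `≤`; equality would make `g` differentiable at a singular point.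
    refine ⟨_, _, hl, hr, lt_of_le_of_ne ?_ fun e => hθ.2 ?_⟩
    · have hc := cos_pos_of_mem (Ioo_subset_Icc_self hθ.1)
      have := hK.leftDeriv_le_rightDeriv_of_mem_interior (hi (tan θ))
      gcongr
    · rw [e] at hr
      have := hl.union hr
      rw [Iic_union_Ici, hasDerivWithinAt_univ] at this
      exact this.differentiableAt

end Yield

theorem theorem3 (g : ℝ → ℝ)
    (hcont : ContinuousOn g (Icc 0 (π / 3)))
    (hpos : ∀ θ ∈ Icc 0 (π / 3), 0 < g θ)
    (hfin : {θ ∈ Ioo 0 (π / 3) | ¬ Yield.TwiceDiffAt g θ}.Finite)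
    (p k : ℝ) (hk : 0 < k) :
    List.TFAE [
      ConvexOn ℝ univ (Yield.devFun g),
      Convex ℝ (Yield.devSection g p k),
      (∀ θ ∈ Ioo 0 (π / 3), Yield.TwiceDiffAt g θ →
          0 ≤ g θ ^ 2 + 2 * deriv g θ ^ 2 - g θ * deriv (deriv g) θ) ∧
        (∃ a, HasDerivWithinAt g a (Ici 0) 0 ∧ a ≤ 0) ∧
        (∃ b, HasDerivWithinAt g b (Iic (π / 3)) (π / 3) ∧ 0 ≤ b) ∧
        (∀ θ ∈ Yield.singularPoints g, ∃ a b,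
          HasDerivWithinAt g a (Iic θ) θ ∧ HasDerivWithinAt g b (Ici θ) θ ∧ b < a)] := by
  rw [Yield.convexOn_devFun_iff, Yield.convex_devSection_iff hpos p hk]
  tfae_have 1 ↔ 2 := Iff.rfl
  tfae_have 1 → 3 := Yield.conditions_of_convexOn hpos
  tfae_have 3 → 1 := fun ⟨hdd, ⟨a, ha, ha0⟩, ⟨b, hb, hb0⟩, hsing⟩ =>
    Yield.convexOn_devStress hpos fun _ ht => Yield.exists_supporting_line_chart hpos
      (Yield.convexOn_chart hcont hpos hfin hdd hsing) ha ha0 hb hb0 ht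
  tfae_finish
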